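/- \textbf{Model.} An acyclic ADT network consists of a finite set $\mathcal V$ of supernodes, each supernode $V$ having finite disjoint sets $I(V)$ of input ports and $O(V)$ of output ports, and a set $\mathcal E$ of edges $(e,e')$ from output ports to input ports, such that the directed graph induced on $\mathcal V$ has no directed cycle. Fix a finite field $\mathbb F_q$, a source $S\in\mathcal V$, destinations $T_1,\dots,T_N\in\mathcal V\setminus\{S\}$, and source symbols $\mathcal X(S)=[X_1,\dots,X_R]$, where $R=|\mathcal X(S)|$. A coding assignment over a field $K\supseteq\mathbb F_q$ is a choice of elements $\alpha_{(k,e)}$ ($1\le k\le R$, $e\in O(S)$), $\beta_{(e',e)}$ ($e'\in I(V)$, $e\in O(V)$, $V\in\mathcal V$) and $\epsilon_{(e',(T_i,k))}$ ($e'\in I(T_i)$, $1\le k\le R$) of $K$. It determines the port symbols $Y$ by $Y(e')=\sum_{(e,e')\in\mathcal E}Y(e)$ at each input port $e'$ and $$Y(e)=\sum_{e'\in I(V)}\beta_{(e',e)}Y(e')+\begin{cases}\sum_{k}\alpha_{(k,e)}X_k,&V=S,\\0,&V\neq S,\end{cases}$$ at each $e\in O(V)$, and destination $T_i$ forms $Z(T_i,k)=\sum_{e'\in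 I(T_i)}\epsilon_{(e',(T_i,k))}Y(e')$. The multicast problem is \emph{solvable over $K$} if some coding assignment over $K$ gives $Z(T_i,k)=X_k$ for all $i$, all $k$ and all values of the source symbols in $K$. Let $F$ be the matrix indexed by the ports with $F_{e,e'}=1$ for $(e,e')\in\mathcal E$, $F_{e',e}=\beta_{(e',e)}$ for $e'\in I(V)$, $e\in O(V)$, and $0$ elsewhere. Let $A$ and $B_i$ be the matrices with $R$ rows and columns indexed by the ports that have entries $\alpha_{(k,e)}$ at $e\in O(S)$, respectively $\epsilon_{(e',(T_i,k))}$ at $e'\in I(T_i)$, and $0$ elsewhere. The $R\times R$ system matrices are $M_i=A(I-F)^{-1}B_i^{T}$. For $\Omega\subseteq\mathcal V$ let $G_\Omega$ be the $0$-$1$ matrix of the edges from output ports of supernodes in $\Omega$ to input ports of supernodes outside $\Omega$, and let $\mathrm{mincut}(S,T)=\min_{\Omega}\operatorname{rank}(G_\Omega)$, the minimum being over all $\Omega$ with $S\in\Omega$, $T\notin\Omega$, and the rank being taken over $\mathbb F_q$. \textbf{Theorem (Single Multicast Theorem).} \begin{enumerate} \item The multicast problem is solvable over some finite extension field of $\mathbb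 F_q$ if and only if $\mathrm{mincut}(S,T_i)\ge|\mathcal X(S)|$ for all $i$. \item For every $q$, if the problem is solvable over $\mathbb F_q$, then $\mathrm{mincut}(S,T_i)\ge|\mathcal X(S)|$ for all $i$. \item If $q>N$, then the problem is solvable over $\mathbb F_q$ itself if and only if $\mathrm{mincut}(S,T_i)\ge|\mathcal X(S)|$ for all $i$; and in that case there is one coding assignment over $\mathbb F_q$ with $\det(M_i)\neq0$ for all $i$ simultaneously. \end{enumerate} -/

import Mathlib

universe u

noncomputable section

/-- An ADT network with supernode set `V`, input ports `I` and output ports `O`.  Every port belongs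
to one supernode; `edge e e'` says that there is an edge from the output port `e` to the input
port `e'`. -/
structure ADTNetwork (V I O : Type*) where
  /-- the supernode owning an input port -/
  inNode : I → V
  /-- the supernode owning an output port -/
  outNode : O → V
  /-- the edges, from output ports to input ports -/
  edge : O → I → Prop

/-- An assignment, with values in `K`, of the coding variables for `R` source processes and `N`
destinations: `α k e` (encoding of process `k` on the output port `e` of the source), `β e' e`
(coding from input port `e'` to output port `e` of the same supernode) and `ε e' i k` (weight of
the input port `e'` of destination `i` in its `k`-th decoded process).  Values at ports to which a
variable does not apply are never used. -/
structure ADTCode (I O K : Type*) (N R : ℕ) where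
  /-- encoding variables -/
  α : Fin R → O → K
  /-- internal coding variables -/
  β : I → O → K
  /-- decoding variables -/
  ε : I → Fin N → Fin R → K

namespace ADTNetwork

/-- There is an edge from supernode `v` to supernode `w`. -/
def Adj {V I O : Type*} (G : ADTNetwork V I O) (v w : V) : Prop :=
  ∃ (e : O) (e' : I), G.outNode e = v ∧ G.inNode e' = w ∧ G.edge e e'

/-- The network has no directed cycle. -/
def Acyclic {V I O : Type*} (G : ADTNetwork V I O) : Prop :=
  ∀ v : V, ¬ Relation.TransGen G.Adj v v

/-! ### Cuts -/

/-- `Ω` is a cut between `s` and `t`. -/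
def IsCut {V : Type*} (s t : V) (Ω : Set V) : Prop := s ∈ Ω ∧ t ∉ Ω

open Classical in
/-- The incidence matrix, over `K`, of the bipartite graph of the edges that lead from the output
ports in `Ω` to the input ports in the complement of `Ω`. -/
def cutMatrix {V I O : Type*} (G : ADTNetwork V I O) (K : Type*) [Field K] (Ω : Set V) :
    Matrix {e : O // G.outNode e ∈ Ω} {e' : I // G.inNode e' ∉ Ω} K :=
  Matrix.of fun e e' => if G.edge e.1 e'.1 then 1 else 0

open Classical in
/-- The minimum over all cuts between `s` and `t` of the rank over `K` of the cut matrix. -/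
def mincut {V I O : Type*} [Fintype I] (G : ADTNetwork V I O) (K : Type*) [Field K] (s t : V) : ℕ :=
  sInf {r : ℕ | ∃ Ω : Set V, IsCut s t Ω ∧ r = (G.cutMatrix K Ω).rank}

/-! ### Processes on the ports, and solvability -/

open Classical in
/-- The symbols `yI`, `yO` on the input and output ports are those produced by the code `c` from the
source symbols `x` at the source `S`: superposition at the input ports, linear coding at the
output ports, plus the encoded source symbols at the output ports of `S`. -/
def IsTransmission {V I O : Type*} [Fintype I] [Fintype O] (G : ADTNetwork V I O)
    {K : Type*} [Field K] {N R : ℕ} (S : V) (c : ADTCode I O K N R)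
    (x : Fin R → K) (yI : I → K) (yO : O → K) : Prop :=
  (∀ e' : I, yI e' = ∑ e : O, if G.edge e e' then yO e else 0) ∧
  (∀ e : O, yO e =
    (∑ e' : I, if G.inNode e' = G.outNode e then c.β e' e * yI e' else 0) +
      if G.outNode e = S then ∑ k : Fin R, c.α k e * x k else 0)

open Classical in
/-- The `k`-th process decoded by destination `i`, located at supernode `T i`. -/
def decoded {V I O : Type*} [Fintype I] (G : ADTNetwork V I O)
    {K : Type*} [Field K] {N R : ℕ} (T : Fin N → V) (c : ADTCode I O K N R)
    (yI : I → K) (i : Fin N) (k : Fin R) : K :=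
  ∑ e' : I, if G.inNode e' = T i then c.ε e' i k * yI e' else 0

/-- The multicast problem of `R` source processes from `S` to all `T i` is solvable over `K`: some
code lets every destination reproduce the source symbols, whatever these are. -/
def Solvable {V I O : Type*} [Fintype I] [Fintype O] (G : ADTNetwork V I O)
    (K : Type*) [Field K] {N : ℕ} (S : V) (T : Fin N → V) (R : ℕ) : Prop :=
  ∃ c : ADTCode I O K N R, ∀ x : Fin R → K,
    (∃ yI yO, G.IsTransmission S c x yI yO) ∧
    ∀ yI yO, G.IsTransmission S c x yI yO → ∀ i, G.decoded T c yI i = x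

/-! ### The system matrix -/

open Classical in
/-- The adjacency matrix `F`, indexed by the ports. -/
def adjMatrix {V I O : Type*} (G : ADTNetwork V I O)
    {K : Type*} [Field K] {N R : ℕ} (c : ADTCode I O K N R) : Matrix (I ⊕ O) (I ⊕ O) K :=
  Matrix.of fun p p' => match p, p' with
    | Sum.inr e, Sum.inl e' => if G.edge e e' then 1 else 0
    | Sum.inl e', Sum.inr e => if G.inNode e' = G.outNode e then c.β e' e else 0
    | _, _ => 0

open Classical in
/-- The encoding matrix `A`. -/
def encMatrix {V I O : Type*} (G : ADTNetwork V I O)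
    {K : Type*} [Field K] {N R : ℕ} (S : V) (c : ADTCode I O K N R) : Matrix (Fin R) (I ⊕ O) K :=
  Matrix.of fun k p => match p with
    | Sum.inr e => if G.outNode e = S then c.α k e else 0
    | Sum.inl _ => 0

open Classical in
/-- The decoding matrix `B_i` of destination `i`. -/
def decMatrix {V I O : Type*} (G : ADTNetwork V I O)
    {K : Type*} [Field K] {N R : ℕ} (T : Fin N → V) (c : ADTCode I O K N R) (i : Fin N) :
    Matrix (Fin R) (I ⊕ O) K :=
  Matrix.of fun k p => match p with
    | Sum.inl e' => if G.inNode e' = T i then c.ε e' i k else 0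
    | Sum.inr _ => 0

open Classical in
/-- The system matrix `M_i = A (1 - F)⁻¹ B_iᵀ` of destination `i`. -/
def systemMatrix {V I O : Type*} [Fintype I] [Fintype O] (G : ADTNetwork V I O)
    {K : Type*} [Field K] {N R : ℕ} (S : V) (T : Fin N → V) (c : ADTCode I O K N R) (i : Fin N) :
    Matrix (Fin R) (Fin R) K :=
  G.encMatrix S c * (1 - G.adjMatrix c)⁻¹ * (G.decMatrix T c i).transpose

end ADTNetwork

end

/-! Necessity: across a cut Ω all symbols received outside Ω depend only on the superpositions
entering from Ω. If a destination recovers every source vector, the map from source vectors to these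
superpositions is injective, so the cut matrix has rank at least `R`.

Sufficiency: up to sign, `M_i` is the Schur complement of `1 - F` in the block matrix `[0, A; B_iᵀ,
1 - F]`, where each coding variable occurs in at most one entry. This is a constant matrix plus free
entries at positions `E`. Over an infinite field such a matrix can reach rank `r` as soon as every
cover of `E` by rows `C` and columns `D` satisfies `r ≤ |C| + |D| + rank` of the constant part with
these lines erased (`exists_le_rank_add_of_cover`). Each supernode contributes a full rectangle to
`E`, so a cover contains all rows or all columns of each supernode. It thus reduces to a cut Ω, for
which the inequality is the rank condition (`card_le_cut_add_rank`).

This makes each of the `N` determinants nonzero over the algebraic closure. They are affine in each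
variable, so fixing a variable excludes at most one value per destination, and `N < q` leaves a
common choice in the given field (`exists_forall_ne_zero_of_affine`). -/

namespace Matrix

/-! ### Ranks under field extension, erasure of lines and change of entries -/

variable {m n K : Type*}

theorem rank_add_le [Fintype n] [Finite m] [Field K] (A B : Matrix m n K) :
    (A + B).rank ≤ A.rank + B.rank := by
  cases nonempty_fintype m
  unfold Matrix.rank
  refine (Submodule.finrank_mono ?_).trans (Submodule.finrank_add_le_finrank_add_finrank _ _)
  rintro _ ⟨v, rfl⟩
  rw [Matrix.mulVecLin_add, LinearMap.add_apply]
  exact Submodule.add_mem_sup ⟨v, rfl⟩ ⟨v, rfl⟩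

theorem le_rank_iff_exists_linearIndependent [Fintype n] [Finite m] [Field K] (A : Matrix m n K)
    (r : ℕ) : r ≤ A.rank ↔ ∃ f : Fin r → m, LinearIndependent K fun i => A (f i) := by
  cases nonempty_fintype m
  constructor
  · intro h
    rw [A.rank_eq_finrank_span_row] at h
    obtain ⟨f, hf, -, hli⟩ := Submodule.exists_fun_fin_finrank_span_eq K (Set.range A.row)
    choose g hg using hf
    refine ⟨fun i => g (Fin.castLE h i), ?_⟩
    have : (fun i => A (g (Fin.castLE h i))) = f ∘ Fin.castLE h := by
      funext i
      exact hg _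
    rw [this]
    exact hli.comp _ (Fin.castLE_injective h)
  · rintro ⟨f, hf⟩
    have h1 : (A.submatrix f id).rank = Fintype.card (Fin r) :=
      LinearIndependent.rank_matrix (M := A.submatrix f id) hf
    rw [Fintype.card_fin] at h1
    rw [← h1]
    exact rank_submatrix_le A f id

/-- Independence of rows survives field extension. Hence min-cuts may be computed over the base
field, an extension or the closure alike. -/
theorem rank_map_algebraMap [Fintype n] [Finite m] [Field K] {L : Type*} [Field L] [Algebra K L]
    (A : Matrix m n K) : (A.map (algebraMap K L)).rank = A.rank := by
  have key : ∀ r, r ≤ (A.map (algebraMap K L)).rank ↔ r ≤ A.rank := by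
    intro r
    rw [le_rank_iff_exists_linearIndependent, le_rank_iff_exists_linearIndependent]
    refine exists_congr fun f => ?_
    exact linearIndependent_algebraMap_comp_iff (R := K) (S := L) (v := fun i => A (f i))
  exact le_antisymm ((key _).1 le_rfl) ((key _).2 le_rfl)

/-- The matrix with the rows in `C` and the columns in `D` replaced by zero. -/
def eraseLines [DecidableEq m] [DecidableEq n] [Zero K] (C : Finset m) (D : Finset n)
    (M : Matrix m n K) : Matrix m n K :=
  of fun i j => if i ∈ C ∨ j ∈ D then 0 else M i j

section

variable [DecidableEq m] [DecidableEq n] [Field K]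

theorem eraseLines_apply (C : Finset m) (D : Finset n) (M : Matrix m n K) (i : m) (j : n) :
    eraseLines C D M i j = if i ∈ C ∨ j ∈ D then 0 else M i j := rfl

variable [Fintype m] [Fintype n]

/-- Erasing one line lowers the rank by at most one. The cover inequality therefore only has to be
checked on smaller sets of lines. -/
theorem rank_eraseLines_anti {C C' : Finset m} {D D' : Finset n} (hC : C' ⊆ C) (hD : D' ⊆ D)
    (M : Matrix m n K) :
    C'.card + D'.card + (eraseLines C' D' M).rank ≤ C.card + D.card + (eraseLines C D M).rank := by
  let X : Matrix m n K := of fun i j => if i ∈ C \ C' then eraseLines C' D' M i j else 0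
  let Y : Matrix m n K :=
    of fun i j => if i ∉ C ∧ j ∈ D \ D' then eraseLines C' D' M i j else 0
  have hsum : eraseLines C' D' M = eraseLines C D M + (X + Y) := by
    ext i j
    have h1 := @hC i
    have h2 := @hD j
    simp only [X, Y, eraseLines_apply, add_apply, of_apply, Finset.mem_sdiff]
    by_cases a : i ∈ C <;> by_cases b : i ∈ C' <;> by_cases c : j ∈ D <;> by_cases d : j ∈ D' <;>
      simp_all
  have hX : X.rank ≤ (C \ C').card := by
    refine rank_le_card_of_support_subset X _ ?_
    rw [Function.support_subset_iff']
    intro i hi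
    ext j
    simp only [Finset.mem_coe] at hi
    simp only [X, row, of_apply, if_neg hi, Pi.zero_apply]
  have hY : Y.rank ≤ (D \ D').card := by
    rw [← rank_transpose]
    refine rank_le_card_of_support_subset _ _ ?_
    rw [Function.support_subset_iff']
    intro j hj
    ext i
    simp only [Finset.mem_coe] at hj
    simp [Y, row, -Finset.mem_sdiff, hj]
  have h3 := rank_add_le (eraseLines C D M) (X + Y)
  have h4 := rank_add_le X Y
  rw [← hsum] at h3
  have h5 := Finset.card_sdiff_add_card_eq_card hC
  have h6 := Finset.card_sdiff_add_card_eq_card hD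
  omega

/-- If both values failed, row `x` with either entry would lie in the span `W` of the other rows.
The difference puts the unit vector at `y` into `W`, so erasing column `y` costs a further
dimension, against `hy`. -/
theorem le_rank_add_single_or (N : Matrix m n K) (x : m) (y : n) {t t' : K} (ht : t ≠ t') {r : ℕ}
    (hx : r ≤ (N.updateRow x 0).rank + 1) (hy : r ≤ (N.updateCol y 0).rank + 1) :
    r ≤ (N + single x y t).rank ∨ r ≤ (N + single x y t').rank := by
  by_contra! hcon
  set W := Submodule.span K (Set.range (N.updateRow x 0).row) with hW
  have hWr : (N.updateRow x 0).rank = Module.finrank K W := rank_eq_finrank_span_row _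
  have hrow : ∀ i, i ≠ x → N i ∈ W := fun i hi =>
    Submodule.subset_span ⟨i, by simp [row, updateRow_ne hi]⟩
  have hle : ∀ s : K, W ≤ Submodule.span K (Set.range (N + single x y s).row) := by
    intro s
    rw [hW, Submodule.span_le]
    rintro _ ⟨i, rfl⟩
    by_cases hi : i = x
    · subst hi
      simp [row]
    · refine Submodule.subset_span ⟨i, ?_⟩
      ext j
      simp [row, updateRow_ne hi, single_apply_of_row_ne (Ne.symm hi)]
  have hmem : ∀ s : K, (N + single x y s).rank < r → N x + Pi.single y s ∈ W := by
    intro s hs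
    rw [rank_eq_finrank_span_row] at hs
    have heq := Submodule.eq_of_le_of_finrank_le (hle s) (by omega)
    rw [heq]
    refine Submodule.subset_span ⟨x, ?_⟩
    ext j
    simp [row, single_apply, Pi.single_apply, eq_comm]
  have h1 := hmem t hcon.1
  have h2 := hmem t' hcon.2
  have hey : Pi.single y (1 : K) ∈ W := by
    have h3 := W.smul_mem (t - t')⁻¹ (W.sub_mem h1 h2)
    convert h3 using 1
    ext j
    by_cases hj : j = y
    · subst hj
      simp [inv_mul_cancel₀ (sub_ne_zero.2 ht)]
    · simp [hj]
  have hNx : N x ∈ W := by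
    have h3 := W.sub_mem h1 (W.smul_mem t hey)
    convert h3 using 1
    ext j
    by_cases hj : j = y
    · subst hj
      simp
    · simp [hj]
  have hall : ∀ i, N i ∈ W := fun i => by
    by_cases hi : i = x
    · exact hi ▸ hNx
    · exact hrow i hi
  -- `π` forgets coordinate `y`. It kills a nonzero vector of `W`, so its image, which contains the
  -- rows of `N.updateCol y 0`, has dimension below that of `W`.
  let π : (n → K) →ₗ[K] (n → K) :=
    LinearMap.pi fun j => if j = y then 0 else LinearMap.proj j
  have hπ : Submodule.span K (Set.range (N.updateCol y 0).row) ≤ LinearMap.range (π.domRestrict W) := by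
    rw [Submodule.span_le]
    rintro _ ⟨i, rfl⟩
    refine ⟨⟨N i, hall i⟩, ?_⟩
    ext j
    by_cases hj : j = y
    · subst hj
      simp [π, row]
    · simp [π, row, hj]
  have hker : 1 ≤ Module.finrank K (LinearMap.ker (π.domRestrict W)) := by
    rw [Submodule.one_le_finrank_iff, Submodule.ne_bot_iff]
    refine ⟨⟨_, hey⟩, ?_, ?_⟩
    · rw [LinearMap.mem_ker]
      ext j
      by_cases hj : j = y
      · subst hj
        simp [π]
      · simp [π, hj]
    · intro h0
      have := congrFun (congrArg Subtype.val h0) y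
      simp at this
  have h5 := LinearMap.finrank_range_add_finrank_ker (π.domRestrict W)
  have h6 := Submodule.finrank_mono hπ
  rw [rank_eq_finrank_span_row] at hy
  have h7 := Submodule.finrank_mono (hle t)
  rw [← rank_eq_finrank_span_row (N + single x y t)] at h7
  have h9 := hcon.1
  omega

/-- If every vertex cover `(C, D)` of the positions `E` satisfies
`r ≤ |C| + |D| + rank (eraseLines C D Q)`, then the rank of `Q` can be raised to at least `r` by
changing the entries at the positions in `E`. -/
theorem exists_le_rank_add_of_cover [Infinite K] (E : Finset (m × n)) (r : ℕ) :
    ∀ (Q : Matrix m n K), (∀ (C : Finset m) (D : Finset n), (∀ p ∈ E, p.1 ∈ C ∨ p.2 ∈ D) →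
      r ≤ C.card + D.card + (eraseLines C D Q).rank) →
    ∃ X : Matrix m n K, (∀ i j, (i, j) ∉ E → X i j = 0) ∧ r ≤ (Q + X).rank := by
  induction E using Finset.induction_on with
  | empty =>
    intro Q h
    refine ⟨0, fun _ _ _ => rfl, ?_⟩
    have := h ∅ ∅ (by simp)
    have he : eraseLines ∅ ∅ Q = Q := by
      ext i j
      simp [eraseLines_apply]
    simpa [he] using this
  | insert p E hp ih =>
    obtain ⟨x, y⟩ := p
    intro Q h
    -- For each cover of `E` only finitely many values `t` at the new position break the inequality:
    -- none if the cover meets that position, otherwise at most one, since adding row `x` or column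
    -- `y` gives covers of the larger set.
    have hbad : ∀ CD : Finset m × Finset n, (∀ p ∈ E, p.1 ∈ CD.1 ∨ p.2 ∈ CD.2) →
        {t : K | ¬ r ≤ CD.1.card + CD.2.card +
          (eraseLines CD.1 CD.2 (Q + single x y t)).rank}.Finite := by
      rintro ⟨C, D⟩ hCD
      dsimp only at hCD ⊢
      by_cases hxy : x ∈ C ∨ y ∈ D
      · convert Set.finite_empty using 1
        rw [Set.eq_empty_iff_forall_notMem]
        intro t ht
        refine ht ?_
        have he : eraseLines C D (Q + single x y t) = eraseLines C D Q := by
          ext i j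
          by_cases hij : x = i ∧ y = j
          · simp [eraseLines_apply, ← hij.1, ← hij.2, hxy]
          · simp [eraseLines_apply, single_apply_of_ne _ _ _ _ _ hij]
        rw [he]
        refine h C D fun p hp => ?_
        rcases Finset.mem_insert.1 hp with rfl | hp
        · exact hxy
        · exact hCD p hp
      · refine Set.Subsingleton.finite ?_
        push Not at hxy
        intro t ht t' ht'
        by_contra hne
        have he : ∀ s, eraseLines C D (Q + single x y s) = eraseLines C D Q + single x y s := by
          intro s
          ext i j
          by_cases hij : x = i ∧ y = j
          · simp [eraseLines_apply, ← hij.1, ← hij.2, hxy]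
          · simp [eraseLines_apply, single_apply_of_ne _ _ _ _ _ hij]
        simp only [Set.mem_ofPred_eq, he, not_le] at ht ht'
        have hx := h (insert x C) D fun p hp => by
          rcases Finset.mem_insert.1 hp with rfl | hp
          · simp
          · rcases hCD p hp with h | h <;> simp [h]
        have hy := h C (insert y D) fun p hp => by
          rcases Finset.mem_insert.1 hp with rfl | hp
          · simp
          · rcases hCD p hp with h | h <;> simp [h]
        have hex : eraseLines (insert x C) D Q = (eraseLines C D Q).updateRow x 0 := by
          ext i j
          by_cases hi : i = x
          · subst hi
            simp [eraseLines_apply]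
          · simp [eraseLines_apply, hi]
        have hey : eraseLines C (insert y D) Q = (eraseLines C D Q).updateCol y 0 := by
          ext i j
          by_cases hj : j = y
          · subst hj
            simp [eraseLines_apply]
          · simp [eraseLines_apply, hj]
        rw [hex, Finset.card_insert_of_notMem hxy.1] at hx
        rw [hey, Finset.card_insert_of_notMem hxy.2] at hy
        have := le_rank_add_single_or (eraseLines C D Q) x y hne (r := r - (C.card + D.card))
          (by omega) (by omega)
        omega
    have hfin : (⋃ CD ∈ {CD : Finset m × Finset n | ∀ p ∈ E, p.1 ∈ CD.1 ∨ p.2 ∈ CD.2},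
        {t : K | ¬ r ≤ CD.1.card + CD.2.card +
          (eraseLines CD.1 CD.2 (Q + single x y t)).rank}).Finite :=
      Set.Finite.biUnion (Set.toFinite _) fun CD hCD => hbad CD hCD
    obtain ⟨t, ht⟩ := hfin.exists_notMem
    simp only [Set.mem_iUnion, Set.mem_ofPred_eq, not_exists, not_not] at ht
    obtain ⟨X, hX, hr⟩ := ih (Q + single x y t) fun C D hCD => ht (C, D) hCD
    refine ⟨single x y t + X, fun i j hij => ?_, by rwa [← add_assoc]⟩
    rw [Finset.mem_insert, not_or] at hij
    rw [add_apply, hX i j hij.2, single_apply_of_ne, add_zero]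
    rintro ⟨rfl, rfl⟩
    exact hij.1 rfl

theorem exists_det_add_single_affine (M : Matrix m m K) (i j : m) (s : K) :
    ∃ a b : K, ∀ t : K, (M + single i j (t * s)).det = a + b * t := by
  refine ⟨M.det, s * (M.updateRow i (Pi.single j 1)).det, fun t => ?_⟩
  have h : M + single i j (t * s) = M.updateRow i (M i + (t * s) • Pi.single j 1) := by
    ext k l
    by_cases hk : k = i
    · subst hk
      simp [single_apply, Pi.single_apply, eq_comm]
    · simp [updateRow_ne hk, single_apply_of_row_ne (Ne.symm hk)]
  rw [h, det_updateRow_add, det_updateRow_smul, updateRow_eq_self]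
  ring

end

end Matrix

/-! ### Common nonzeros of functions affine in each variable -/

/-- Finitely many functions that are affine in each variable separately, each of them not
identically zero, have a common nonzero with coordinates in any set that is larger than the number
of functions. -/
theorem exists_forall_ne_zero_of_affine {σ K ι : Type*} [Finite σ] [Fintype ι] [Field K]
    (f : ι → (σ → K) → K)
    (haff : ∀ i (v : σ → K) j, ∃ a b : K, ∀ (t : K) (w : σ → K), w j = t →
      (∀ k, k ≠ j → w k = v k) → f i w = a + b * t)
    (hne : ∀ i, ∃ v, f i v ≠ 0) (A : Finset K) (hA : Fintype.card ι < A.card) :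
    ∃ v : σ → K, (∀ j, v j ∈ A) ∧ ∀ i, f i v ≠ 0 := by
  classical
  cases nonempty_fintype σ
  -- Each `f i` keeps its own nonzero `v`; only the coordinates in `s` are common to all of them.
  have key : ∀ s : Finset σ, ∃ u : σ → K, (∀ j ∈ s, u j ∈ A) ∧
      ∀ i, ∃ v : σ → K, (∀ j ∈ s, v j = u j) ∧ f i v ≠ 0 := by
    intro s
    induction s using Finset.induction_on with
    | empty => exact ⟨0, by simp, fun i => (hne i).imp fun v hv => ⟨by simp, hv⟩⟩
    | insert j s hj ih =>
      obtain ⟨u, huA, hu⟩ := ih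
      choose v hvu hv using hu
      choose a b hab using fun i => haff i (v i) j
      have hupd : ∀ i t, f i (Function.update (v i) j t) = a i + b i * t := fun i t =>
        hab i t _ (by simp) fun k hk => by simp [hk]
      -- The only value that can kill `f i` is the root `-a i / b i`. When `b i = 0` the function is
      -- constant in coordinate `j`, and excluding the junk value does no harm.
      have hcard : (Finset.univ.image fun i => -a i / b i).card < A.card :=
        lt_of_le_of_lt Finset.card_image_le (by simpa using hA)
      obtain ⟨t, htA, ht⟩ := Finset.exists_mem_notMem_of_card_lt_card hcard
      refine ⟨Function.update u j t, fun k hk => ?_, fun i =>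
        ⟨Function.update (v i) j t, fun k hk => ?_, fun h0 => ?_⟩⟩
      · by_cases hkj : k = j
        · subst hkj
          simpa using htA
        · simpa [hkj] using huA k ((Finset.mem_insert.1 hk).resolve_left hkj)
      · by_cases hkj : k = j
        · subst hkj
          simp
        · simpa [hkj] using hvu i k ((Finset.mem_insert.1 hk).resolve_left hkj)
      · rw [hupd] at h0
        by_cases hb : b i = 0
        · have := hab i (v i j) (v i) rfl fun _ _ => rfl
          rw [hb, zero_mul] at h0 this
          exact hv i (this.trans h0)
        · refine ht (Finset.mem_image.2 ⟨i, Finset.mem_univ _, ?_⟩)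
          rw [div_eq_iff hb]
          linear_combination -h0
  obtain ⟨u, huA, hu⟩ := key Finset.univ
  refine ⟨u, fun j => huA j (Finset.mem_univ _), fun i => ?_⟩
  obtain ⟨v, hv, hf⟩ := hu i
  rwa [← show v = u from funext fun j => hv j (Finset.mem_univ _)]

namespace ADTNetwork

open Matrix

section

variable {V I O : Type*} (G : ADTNetwork V I O)

/-! ### Cuts -/

theorem cutMatrix_map {F K : Type*} [Field F] [Field K] [Algebra F K] (Ω : Set V) :
    (G.cutMatrix F Ω).map (algebraMap F K) = G.cutMatrix K Ω := by
  ext e e'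
  simp only [cutMatrix, map_apply, of_apply]
  split_ifs <;> simp

variable [Fintype I]

open Classical in
theorem le_mincut_iff {K : Type*} [Field K] {s t : V} (h : t ≠ s) (r : ℕ) :
    r ≤ G.mincut K s t ↔ ∀ Ω, IsCut s t Ω → r ≤ (G.cutMatrix K Ω).rank := by
  constructor
  · intro hr Ω hΩ
    exact hr.trans (Nat.sInf_le ⟨Ω, hΩ, rfl⟩)
  · intro hr
    refine le_csInf ⟨_, {s}, ⟨rfl, h⟩, rfl⟩ ?_
    rintro _ ⟨Ω, hΩ, rfl⟩
    exact hr Ω hΩ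

theorem mincut_algebra {F K : Type*} [Field F] [Field K] [Algebra F K] [Finite O] (s t : V) :
    G.mincut K s t = G.mincut F s t := by
  classical
  unfold mincut
  congr 1
  ext r
  refine exists_congr fun Ω => and_congr_right fun _ => ?_
  rw [← G.cutMatrix_map (F := F) (K := K), rank_map_algebraMap]

end

/-! ### Transmissions in acyclic networks -/

section

variable {V I O : Type*} {G : ADTNetwork V I O}

theorem Acyclic.wellFounded [Finite V] (hG : G.Acyclic) : WellFounded G.Adj := by
  have : Std.Irrefl (Relation.TransGen G.Adj) := ⟨hG⟩
  exact Subrelation.wf (fun h => Relation.TransGen.single h)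
    (Finite.wellFounded_of_trans_of_irrefl (Relation.TransGen G.Adj))

variable [Fintype I] [Fintype O] {K : Type*} [Field K] {N R : ℕ} {S : V} {c : ADTCode I O K N R}

open Classical in
/-- If nothing enters the complement of `Ω`, neither from the source nor across the cut, then all
symbols received in the complement of `Ω` vanish. -/
theorem IsTransmission.eq_zero_of_cut [Finite V] (hG : G.Acyclic) {x : Fin R → K} {yI : I → K}
    {yO : O → K} (h : G.IsTransmission S c x yI yO) (Ω : Set V) (hS : S ∈ Ω ∨ x = 0)
    (hcut : ∀ e', G.inNode e' ∉ Ω →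
      ∑ e : {e // G.outNode e ∈ Ω}, (if G.edge e.1 e' then yO e.1 else 0) = 0) :
    ∀ e', G.inNode e' ∉ Ω → yI e' = 0 := by
  suffices H : ∀ v, v ∉ Ω → ∀ e', G.inNode e' = v → yI e' = 0 from fun e' he' => H _ he' e' rfl
  intro v
  induction v using hG.wellFounded.induction with
  | _ v ih =>
    rintro hv e' rfl
    rw [h.1 e', ← Fintype.sum_subtype_add_sum_subtype (fun e => G.outNode e ∈ Ω), hcut e' hv,
      zero_add]
    refine Finset.sum_eq_zero fun e _ => ?_
    split_ifs with hedge
    · have hin : ∀ f', G.inNode f' = G.outNode e.1 → yI f' = 0 :=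
        ih _ ⟨e.1, e', rfl, rfl, hedge⟩ e.2
      rw [h.2 e.1]
      have h1 : (∑ f' : I, if G.inNode f' = G.outNode e.1 then c.β f' e.1 * yI f' else 0) = 0 := by
        refine Finset.sum_eq_zero fun f' _ => ?_
        split_ifs with hf
        · rw [hin f' hf, mul_zero]
        · rfl
      rw [h1, zero_add]
      split_ifs with hs
      · rcases hS with hS | rfl
        · exact absurd (hs ▸ hS) e.2
        · simp
      · rfl
    · rfl

open Classical in
theorem isTransmission_iff (x : Fin R → K) (y : I ⊕ O → K) :
    G.IsTransmission S c x (fun e' => y (Sum.inl e')) (fun e => y (Sum.inr e)) ↔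
      y ᵥ* (1 - G.adjMatrix c) = x ᵥ* G.encMatrix S c := by
  rw [vecMul_sub, vecMul_one, sub_eq_iff_eq_add, funext_iff, Sum.forall]
  unfold IsTransmission
  refine and_congr (forall_congr' fun e' => ?_) (forall_congr' fun e => ?_)
  · simp [vecMul, dotProduct, adjMatrix, encMatrix]
  · rw [add_comm]
    simp [vecMul, dotProduct, adjMatrix, encMatrix, mul_comm]

-- A left null vector of `1 - F` is a transmission of the zero source vector, and acyclicity forces
-- it to vanish, by the cut lemma with Ω empty.
open Classical in
theorem Acyclic.det_ne_zero [Finite V] (hG : G.Acyclic) (c : ADTCode I O K N R) :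
    (1 - G.adjMatrix c).det ≠ 0 := by
  intro hdet
  obtain ⟨y, hy, hy0⟩ := exists_vecMul_eq_zero_iff.2 hdet
  rcases isEmpty_or_nonempty V with hV | ⟨⟨S⟩⟩
  · refine hy (funext fun p => ?_)
    rcases p with e' | e
    · exact isEmptyElim (G.inNode e')
    · exact isEmptyElim (G.outNode e)
  have ht : G.IsTransmission S c 0 (fun e' => y (Sum.inl e')) (fun e => y (Sum.inr e)) := by
    rw [isTransmission_iff, hy0, zero_vecMul]
  have hI : ∀ e', y (Sum.inl e') = 0 := fun e' =>
    ht.eq_zero_of_cut hG ∅ (Or.inr rfl) (fun _ _ => Finset.sum_eq_zero fun e _ => e.2.elim) e'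
      (Set.notMem_empty _)
  refine hy (funext fun p => ?_)
  rcases p with e' | e
  · exact hI e'
  · exact (ht.2 e).trans (by simp [hI])

open Classical in
theorem Acyclic.isTransmission_iff_eq [Finite V] (hG : G.Acyclic) (x : Fin R → K)
    (y : I ⊕ O → K) :
    G.IsTransmission S c x (fun e' => y (Sum.inl e')) (fun e => y (Sum.inr e)) ↔
      y = x ᵥ* (G.encMatrix S c * (1 - G.adjMatrix c)⁻¹) := by
  have hu : IsUnit (1 - G.adjMatrix c).det := (hG.det_ne_zero c).isUnit
  rw [isTransmission_iff]
  constructor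
  · intro h
    rw [← vecMul_vecMul, ← h, vecMul_vecMul, mul_nonsing_inv _ hu, vecMul_one]
  · rintro rfl
    rw [vecMul_vecMul, Matrix.mul_assoc, nonsing_inv_mul _ hu, Matrix.mul_one]

open Classical in
theorem decoded_eq (T : Fin N → V) (y : I ⊕ O → K) (i : Fin N) :
    G.decoded T c (fun e' => y (Sum.inl e')) i = y ᵥ* (G.decMatrix T c i)ᵀ := by
  ext k
  simp [decoded, vecMul, dotProduct, decMatrix, mul_comm]

/-- The rank of every cut between the source and a destination bounds the number of processes that
can be transmitted. -/
theorem Solvable.le_mincut [Finite V] (hG : G.Acyclic) {T : Fin N → V} (hST : ∀ i, T i ≠ S)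
    (h : G.Solvable K S T R) (i : Fin N) : R ≤ G.mincut K S (T i) := by
  classical
  rw [G.le_mincut_iff (hST i)]
  rintro Ω ⟨hS, hT⟩
  obtain ⟨c, hc⟩ := h
  let P := G.encMatrix S c * (1 - G.adjMatrix c)⁻¹
  let ψ : (Fin R → K) →ₗ[K] ({e // G.outNode e ∈ Ω} → K) :=
    -- `ψ` gives the symbols sent by the output ports inside Ω.
    LinearMap.funLeft K K (fun e => Sum.inr e.1) ∘ₗ P.vecMulLinear
  have hinj : Function.Injective ((G.cutMatrix K Ω)ᵀ.mulVecLin ∘ₗ ψ) := by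
    rw [← LinearMap.ker_eq_bot, LinearMap.ker_eq_bot']
    intro x hx
    have ht := (hG.isTransmission_iff_eq (S := S) (c := c) x (x ᵥ* P)).2 rfl
    rw [← (hc x).2 _ _ ht i]
    have hzero := ht.eq_zero_of_cut hG Ω (Or.inl hS) fun e' he' => by
      have := congrFun hx ⟨e', he'⟩
      simpa only [ψ, LinearMap.comp_apply, mulVecLin_apply, mulVec_transpose,
        vecMul_eq_sum, Finset.sum_apply, Pi.smul_apply, smul_eq_mul, cutMatrix, of_apply,
        mul_ite, mul_one, mul_zero, LinearMap.funLeft_apply, vecMulLinear_apply,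
        Pi.zero_apply] using this
    ext k
    refine Finset.sum_eq_zero fun e' _ => ?_
    split_ifs with he
    · exact mul_eq_zero_of_right _ (hzero e' (he ▸ hT))
    · rfl
  have h1 := LinearMap.finrank_range_of_inj hinj
  rw [Module.finrank_fin_fun] at h1
  rw [← rank_transpose, ← h1]
  exact Submodule.finrank_mono (LinearMap.range_comp_le_range _ _)

-- Correcting the decoding variables by the inverse of the system matrix turns it into the identity.
open Classical in
theorem solvable_of_det_systemMatrix_ne_zero [Finite V] (hG : G.Acyclic) {T : Fin N → V}
    (h : ∀ i, (G.systemMatrix S T c i).det ≠ 0) : G.Solvable K S T R := by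
  let c' : ADTCode I O K N R :=
    { c with ε := fun e' i k => ∑ l, c.ε e' i l * (G.systemMatrix S T c i)⁻¹ l k }
  have hdec : ∀ i, (G.decMatrix T c' i)ᵀ = (G.decMatrix T c i)ᵀ * (G.systemMatrix S T c i)⁻¹ := by
    intro i
    ext p k
    rcases p with e' | e
    · by_cases he : G.inNode e' = T i <;> simp [decMatrix, mul_apply, c', he]
    · simp [decMatrix, mul_apply]
  refine ⟨c', fun x => ⟨⟨_, _, (hG.isTransmission_iff_eq x _).2 rfl⟩, fun yI yO hy i => ?_⟩⟩
  have hy' := (hG.isTransmission_iff_eq x (Sum.elim yI yO)).1 hy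
  have hd := decoded_eq (G := G) (c := c') T (Sum.elim yI yO) i
  refine hd.trans ?_
  rw [hdec, hy', vecMul_vecMul, ← Matrix.mul_assoc]
  change x ᵥ* (G.systemMatrix S T c i * _) = x
  rw [mul_nonsing_inv _ (h i).isUnit, vecMul_one]

/-! ### The transfer matrix of a destination -/

open Classical in
/-- A block matrix in which every coding variable occurs in one entry at most, and whose Schur
complement is the system matrix up to sign. -/
noncomputable def transferMatrix (G : ADTNetwork V I O) (S : V) (T : Fin N → V) (c : ADTCode I O K N R)
    (i : Fin N) : Matrix (Fin R ⊕ (I ⊕ O)) (Fin R ⊕ (I ⊕ O)) K :=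
  fromBlocks 0 (G.encMatrix S c) (G.decMatrix T c i)ᵀ (1 - G.adjMatrix c)

open Classical in
theorem Acyclic.det_systemMatrix_ne_zero [Finite V] (hG : G.Acyclic) {T : Fin N → V} {i : Fin N}
    (h : (G.transferMatrix S T c i).det ≠ 0) : (G.systemMatrix S T c i).det ≠ 0 := by
  have hu : IsUnit (1 - G.adjMatrix c).det := (hG.det_ne_zero c).isUnit
  let _ := invertibleOfIsUnitDet _ hu
  rw [transferMatrix, det_fromBlocks₂₂, invOf_eq_nonsing_inv, zero_sub, det_neg] at h
  exact right_ne_zero_of_mul (right_ne_zero_of_mul h)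

end

end ADTNetwork

/-! ### Covers of the variable positions and cuts of the network -/

namespace ADTNetwork

open Matrix

section

variable {V I O : Type*} [Fintype I] [Fintype O] (G : ADTNetwork V I O)
  (K : Type*) [Field K] {N R : ℕ} {S : V}

/-- The supernode through whose coding variables a row of the transfer matrix can be changed; the
source processes are regarded as additional inputs of the source. -/
def rowNode (R : ℕ) (S : V) : Fin R ⊕ (I ⊕ O) → Option V
  | Sum.inl _ => some S
  | Sum.inr (Sum.inl e') => some (G.inNode e')
  | Sum.inr (Sum.inr _) => none

/-- The supernode through whose coding variables a column of the transfer matrix can be changed;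
the decoded processes are regarded as additional outputs of the destination. -/
def colNode (R : ℕ) (t : V) : Fin R ⊕ (I ⊕ O) → Option V
  | Sum.inl _ => some t
  | Sum.inr (Sum.inl _) => none
  | Sum.inr (Sum.inr e) => some (G.outNode e)

open Classical in
/-- The part of the transfer matrix that does not depend on the coding variables. -/
noncomputable def constMatrix (R : ℕ) : Matrix (Fin R ⊕ (I ⊕ O)) (Fin R ⊕ (I ⊕ O)) K :=
  fromBlocks 0 0 0 (1 - G.adjMatrix (K := K) (N := 0) (R := 0) ⟨0, 0, 0⟩)

open Classical in
/-- The rows of the supernodes outside `Ω`. -/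
noncomputable def cutRows (R : ℕ) (S : V) (Ω : Set V) : Finset (Fin R ⊕ (I ⊕ O)) :=
  Finset.univ.filter fun p => ∃ v ∉ Ω, G.rowNode R S p = some v

open Classical in
/-- The columns of the supernodes in `Ω`. -/
noncomputable def cutCols (R : ℕ) (t : V) (Ω : Set V) : Finset (Fin R ⊕ (I ⊕ O)) :=
  Finset.univ.filter fun p => ∃ v ∈ Ω, G.colNode R t p = some v

section

variable {G}
variable {t : V} {Ω : Set V}

theorem mem_cutRows {p : Fin R ⊕ (I ⊕ O)} :
    p ∈ G.cutRows R S Ω ↔ ∃ v ∉ Ω, G.rowNode R S p = some v := by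
  classical
  exact Finset.mem_filter_univ p

theorem mem_cutCols {p : Fin R ⊕ (I ⊕ O)} :
    p ∈ G.cutCols R t Ω ↔ ∃ v ∈ Ω, G.colNode R t p = some v := by
  classical
  exact Finset.mem_filter_univ p

@[simp]
theorem inl_mem_cutRows (k : Fin R) : Sum.inl k ∈ G.cutRows R S Ω ↔ S ∉ Ω := by
  simp [mem_cutRows, rowNode]

@[simp]
theorem inr_inl_mem_cutRows (e' : I) :
    Sum.inr (Sum.inl e') ∈ G.cutRows R S Ω ↔ G.inNode e' ∉ Ω := by
  simp [mem_cutRows, rowNode]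

@[simp]
theorem inr_inr_notMem_cutRows (e : O) : Sum.inr (Sum.inr e) ∉ G.cutRows R S Ω := by
  simp [mem_cutRows, rowNode]

@[simp]
theorem inl_mem_cutCols (k : Fin R) : Sum.inl k ∈ G.cutCols R t Ω ↔ t ∈ Ω := by
  simp [mem_cutCols, colNode]

@[simp]
theorem inr_inl_notMem_cutCols (e' : I) : Sum.inr (Sum.inl e') ∉ G.cutCols R t Ω := by
  simp [mem_cutCols, colNode]

@[simp]
theorem inr_inr_mem_cutCols (e : O) :
    Sum.inr (Sum.inr e) ∈ G.cutCols R t Ω ↔ G.outNode e ∈ Ω := by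
  simp [mem_cutCols, colNode]

end

open Classical in
theorem card_cutRows (R : ℕ) (S : V) (Ω : Set V) :
    (G.cutRows R S Ω).card =
      (if S ∈ Ω then 0 else R) + Fintype.card {e' // G.inNode e' ∉ Ω} := by
  rw [← Finset.filter_univ_mem (G.cutRows R S Ω), Finset.card_filter, Fintype.sum_sum_type,
    Fintype.sum_sum_type, Fintype.card_subtype, Finset.card_filter]
  by_cases h : S ∈ Ω <;> simp [h]

open Classical in
theorem card_cutCols (R : ℕ) (t : V) (Ω : Set V) :
    (G.cutCols R t Ω).card =
      (if t ∈ Ω then R else 0) + Fintype.card {e // G.outNode e ∈ Ω} := by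
  rw [← Finset.filter_univ_mem (G.cutCols R t Ω), Finset.card_filter, Fintype.sum_sum_type,
    Fintype.sum_sum_type, Fintype.card_subtype, Finset.card_filter]
  by_cases h : t ∈ Ω <;> simp [h]

-- A kernel vector of the erased matrix vanishes at input ports inside Ω, restricts to a kernel
-- vector of the cut matrix outside Ω, and is determined at output ports outside Ω by its input-port
-- coordinates. This bounds the nullity. If Ω is not a cut, the erased lines include `R` source rows
-- or `R` destination columns, which compensate.
open Classical in
theorem card_le_cut_add_rank (Ω : Set V) (S t : V)
    (hΩ : IsCut S t Ω → R ≤ (G.cutMatrix K Ω).rank) :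
    R + (Fintype.card I + Fintype.card O) ≤ (G.cutRows R S Ω).card + (G.cutCols R t Ω).card +
      (eraseLines (G.cutRows R S Ω) (G.cutCols R t Ω) (G.constMatrix K R)).rank := by
  set M := eraseLines (G.cutRows R S Ω) (G.cutCols R t Ω) (G.constMatrix K R) with hM
  have hrowI : ∀ w e', G.inNode e' ∈ Ω →
      (M *ᵥ w) (Sum.inr (Sum.inl e')) = w (Sum.inr (Sum.inl e')) := by
    intro w e' he
    simp [hM, mulVec, dotProduct, eraseLines_apply, constMatrix, adjMatrix, he, one_apply]
  have hrowO : ∀ w e, (M *ᵥ w) (Sum.inr (Sum.inr e)) =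
      -(∑ e', if G.edge e e' then w (Sum.inr (Sum.inl e')) else 0) +
        if G.outNode e ∈ Ω then 0 else w (Sum.inr (Sum.inr e)) := by
    intro w e
    simp [hM, mulVec, dotProduct, eraseLines_apply, constMatrix, adjMatrix, one_apply, ← Finset.sum_neg_distrib]
    rw [Fintype.sum_eq_single e fun x hx => by simp [Ne.symm hx]]
    simp
  have hker : ∀ w : LinearMap.ker M.mulVecLin, ∀ p, (M *ᵥ w.1) p = 0 := fun w p =>
    congrFun (LinearMap.mem_ker.1 w.2) p
  have hkerI : ∀ (w : LinearMap.ker M.mulVecLin) e', G.inNode e' ∈ Ω →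
      w.1 (Sum.inr (Sum.inl e')) = 0 := fun w e' he => by
    rw [← hrowI w.1 e' he, hker]
  let f : LinearMap.ker M.mulVecLin →ₗ[K] ({e' // G.inNode e' ∉ Ω} → K) :=
    LinearMap.funLeft K K (fun e' => Sum.inr (Sum.inl e'.1)) ∘ₗ
      (LinearMap.ker M.mulVecLin).subtype
  have hf : ∀ w, f w ∈ LinearMap.ker (G.cutMatrix K Ω).mulVecLin := by
    intro w
    rw [LinearMap.mem_ker]
    ext e
    have h1 := hker w (Sum.inr (Sum.inr e.1))
    rw [hrowO, if_pos e.2, add_zero, neg_eq_zero,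
      ← Fintype.sum_subtype_add_sum_subtype (fun e' => G.inNode e' ∉ Ω)] at h1
    rw [Finset.sum_eq_zero (s := (Finset.univ : Finset {e' // ¬ G.inNode e' ∉ Ω}))
      (fun e' _ => by rw [hkerI w e'.1 (not_not.1 e'.2), ite_self]), add_zero] at h1
    simpa [mulVec, dotProduct, cutMatrix, f, LinearMap.funLeft_apply] using h1
  let Φ : LinearMap.ker M.mulVecLin →ₗ[K]
      ((Fin R → K) × ({e // G.outNode e ∈ Ω} → K)) × LinearMap.ker (G.cutMatrix K Ω).mulVecLin :=
    ((LinearMap.funLeft K K Sum.inl ∘ₗ (LinearMap.ker M.mulVecLin).subtype).prod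
      (LinearMap.funLeft K K (fun e => Sum.inr (Sum.inr e.1)) ∘ₗ
        (LinearMap.ker M.mulVecLin).subtype)).prod (f.codRestrict _ hf)
  have hinj : Function.Injective Φ := by
    rw [← LinearMap.ker_eq_bot, LinearMap.ker_eq_bot']
    intro w hw
    have h1 : ∀ k, w.1 (Sum.inl k) = 0 := fun k => congrFun (congrArg (fun z => z.1.1) hw) k
    have h2 : ∀ e, G.outNode e ∈ Ω → w.1 (Sum.inr (Sum.inr e)) = 0 := fun e he =>
      congrFun (congrArg (fun z => z.1.2) hw) ⟨e, he⟩
    have h3 : ∀ e', w.1 (Sum.inr (Sum.inl e')) = 0 := fun e' => by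
      by_cases he : G.inNode e' ∈ Ω
      · exact hkerI w e' he
      · exact congrFun (congrArg (fun z => z.2.1) hw) ⟨e', he⟩
    ext p
    rcases p with k | e' | e
    · exact h1 k
    · exact h3 e'
    · by_cases he : G.outNode e ∈ Ω
      · exact h2 e he
      · have h4 := hker w (Sum.inr (Sum.inr e))
        rw [hrowO, if_neg he] at h4
        simpa [h3] using h4
  have h1 := LinearMap.finrank_le_finrank_of_injective hinj
  rw [Module.finrank_prod, Module.finrank_prod, Module.finrank_fin_fun,
    Module.finrank_fintype_fun_eq_card] at h1
  have h2 : M.rank + Module.finrank K (LinearMap.ker M.mulVecLin) = _ :=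
    M.mulVecLin.finrank_range_add_finrank_ker
  have h3 : (G.cutMatrix K Ω).rank +
      Module.finrank K (LinearMap.ker (G.cutMatrix K Ω).mulVecLin) = _ :=
    (G.cutMatrix K Ω).mulVecLin.finrank_range_add_finrank_ker
  rw [Module.finrank_fintype_fun_eq_card] at h2 h3
  rw [Fintype.card_sum, Fintype.card_sum, Fintype.card_fin] at h2
  rw [card_cutRows, card_cutCols]
  by_cases hS : S ∈ Ω
  · by_cases ht : t ∈ Ω
    · simp only [hS, ht, if_true]
      omega
    · have := hΩ ⟨hS, ht⟩
      simp only [hS, ht, if_true, if_false]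
      omega
  · simp only [hS, if_false]
    omega

open Classical in
/-- Over an infinite field, a destination that no cut separates from the source by a rank smaller
than `R` has a regular transfer matrix for some code. -/
theorem exists_code_det_transferMatrix_ne_zero [Infinite K] (T : Fin N → V) (i : Fin N)
    (hS : T i ≠ S) (hcut : ∀ Ω, IsCut S (T i) Ω → R ≤ (G.cutMatrix K Ω).rank) :
    ∃ c : ADTCode I O K N R, (G.transferMatrix S T c i).det ≠ 0 := by
  let E : Finset ((Fin R ⊕ (I ⊕ O)) × (Fin R ⊕ (I ⊕ O))) :=
    Finset.univ.filter fun p => ∃ v, G.rowNode R S p.1 = some v ∧ G.colNode R (T i) p.2 = some v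
  obtain ⟨X, hX, hrank⟩ := exists_le_rank_add_of_cover E
    (R + (Fintype.card I + Fintype.card O)) (G.constMatrix K R) (by
      intro C D hCD
      -- Supernodes with a row missing from `C`: the cover must contain all their columns, and all
      -- rows of the other supernodes.
      let Ω : Set V := {v | ∃ p, G.rowNode R S p = some v ∧ p ∉ C}
      refine (G.card_le_cut_add_rank K Ω S (T i) (hcut Ω)).trans (rank_eraseLines_anti ?_ ?_ _)
      · intro p hp
        obtain ⟨v, hv, hpv⟩ := mem_cutRows.1 hp
        by_contra hpC
        exact hv ⟨p, hpv, hpC⟩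
      · intro q hq
        obtain ⟨v, ⟨p, hpv, hpC⟩, hqv⟩ := mem_cutCols.1 hq
        exact (hCD (p, q) (by simpa [E] using ⟨v, hpv, hqv⟩)).resolve_left hpC)
  replace hX : ∀ p q, (∀ v, G.rowNode R S p = some v → G.colNode R (T i) q ≠ some v) →
      X p q = 0 := fun p q h => hX p q (by simpa [E] using h)
  let c : ADTCode I O K N R :=
    { α := fun k e => X (Sum.inl k) (Sum.inr (Sum.inr e))
      -- The sign comes from `1 - F`.
      β := fun e' e => -X (Sum.inr (Sum.inl e')) (Sum.inr (Sum.inr e))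
      ε := fun e' _ k => X (Sum.inr (Sum.inl e')) (Sum.inl k) }
  have hc : G.constMatrix K R + X = G.transferMatrix S T c i := by
    ext p q
    rcases p with k | e' | e <;> rcases q with l | f' | f
    -- `T i ≠ S` keeps free entries out of the zero block.
    · simp [constMatrix, transferMatrix, hX (Sum.inl k) (Sum.inl l)
        (by simp [rowNode, colNode, hS])]
    · simp [constMatrix, transferMatrix, encMatrix, hX (Sum.inl k) (Sum.inr (Sum.inl f'))
        (by simp [rowNode, colNode])]
    · by_cases h : G.outNode f = S
      · simp [constMatrix, transferMatrix, encMatrix, h, c]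
      · simp [constMatrix, transferMatrix, encMatrix, h, hX (Sum.inl k) (Sum.inr (Sum.inr f))
          (by simp [rowNode, colNode, h])]
    · by_cases h : G.inNode e' = T i
      · simp [constMatrix, transferMatrix, decMatrix, h, c]
      · simp [constMatrix, transferMatrix, decMatrix, h, hX (Sum.inr (Sum.inl e')) (Sum.inl l)
          (by simp [rowNode, colNode, Ne.symm h])]
    · simp [constMatrix, transferMatrix, adjMatrix,
        hX (Sum.inr (Sum.inl e')) (Sum.inr (Sum.inl f')) (by simp [rowNode, colNode])]
    · by_cases h : G.inNode e' = G.outNode f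
      · simp [constMatrix, transferMatrix, adjMatrix, h, c]
      · simp [constMatrix, transferMatrix, adjMatrix, h,
          hX (Sum.inr (Sum.inl e')) (Sum.inr (Sum.inr f))
          (by simp [rowNode, colNode, Ne.symm h])]
    · simp [constMatrix, transferMatrix, decMatrix,
        hX (Sum.inr (Sum.inr e)) (Sum.inl l) (by simp [rowNode])]
    · simp [constMatrix, transferMatrix, adjMatrix,
        hX (Sum.inr (Sum.inr e)) (Sum.inr (Sum.inl f')) (by simp [rowNode])]
    · simp [constMatrix, transferMatrix, adjMatrix,
        hX (Sum.inr (Sum.inr e)) (Sum.inr (Sum.inr f)) (by simp [rowNode])]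
  refine ⟨c, fun h0 => ?_⟩
  rw [hc] at hrank
  obtain ⟨v, hv, hv0⟩ := exists_mulVec_eq_zero_iff.2 h0
  have h2 : (G.transferMatrix S T c i).rank +
      Module.finrank K (LinearMap.ker (G.transferMatrix S T c i).mulVecLin) = _ :=
    (G.transferMatrix S T c i).mulVecLin.finrank_range_add_finrank_ker
  have h3 : 1 ≤ Module.finrank K (LinearMap.ker (G.transferMatrix S T c i).mulVecLin) := by
    rw [Submodule.one_le_finrank_iff, Submodule.ne_bot_iff]
    exact ⟨v, hv0, hv⟩
  rw [Module.finrank_fintype_fun_eq_card, Fintype.card_sum, Fintype.card_sum,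
    Fintype.card_fin] at h2
  omega

/-- The code with the given values of all coding variables. -/
def codeOf {I O K : Type*} {N R : ℕ}
    (v : (Fin R × O) ⊕ (I × O) ⊕ (I × Fin N × Fin R) → K) : ADTCode I O K N R where
  α k e := v (Sum.inl (k, e))
  β e' e := v (Sum.inr (Sum.inl (e', e)))
  ε e' i k := v (Sum.inr (Sum.inr (e', i, k)))

variable {K}

open Classical in
theorem det_transferMatrix_codeOf_affine (T : Fin N → V) (i : Fin N)
    (v : (Fin R × O) ⊕ (I × O) ⊕ (I × Fin N × Fin R) → K)
    (j : (Fin R × O) ⊕ (I × O) ⊕ (I × Fin N × Fin R)) :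
    ∃ a b : K, ∀ (t : K) (w : (Fin R × O) ⊕ (I × O) ⊕ (I × Fin N × Fin R) → K), w j = t →
      (∀ k, k ≠ j → w k = v k) →
        (G.transferMatrix S T (codeOf w) i).det = a + b * t := by
  suffices H : ∃ p q s, ∀ t, G.transferMatrix S T (codeOf (Function.update v j t)) i =
      G.transferMatrix S T (codeOf (Function.update v j 0)) i + single p q (t * s) by
    obtain ⟨p, q, s, h⟩ := H
    obtain ⟨a, b, hab⟩ := exists_det_add_single_affine
      (G.transferMatrix S T (codeOf (Function.update v j 0)) i) p q s
    refine ⟨a, b, fun t w hwj hw => ?_⟩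
    rw [Function.eq_update_iff.2 ⟨hwj, hw⟩, h, hab]
  rcases j with ⟨k, e⟩ | ⟨e', e⟩ | ⟨e', i', k⟩
  · refine ⟨Sum.inl k, Sum.inr (Sum.inr e), if G.outNode e = S then 1 else 0, fun t => ?_⟩
    ext p q
    rcases p with l | f' | f <;> rcases q with m | g' | g <;>
      simp [transferMatrix, encMatrix, decMatrix, adjMatrix, codeOf, single_apply,
        Function.update_apply]
    grind
  · refine ⟨Sum.inr (Sum.inl e'), Sum.inr (Sum.inr e),
      if G.inNode e' = G.outNode e then -1 else 0, fun t => ?_⟩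
    ext p q
    rcases p with l | f' | f <;> rcases q with m | g' | g <;>
      simp [transferMatrix, encMatrix, decMatrix, adjMatrix, codeOf, single_apply,
        Function.update_apply]
    grind
  · refine ⟨Sum.inr (Sum.inl e'), Sum.inl k,
      if i' = i ∧ G.inNode e' = T i then 1 else 0, fun t => ?_⟩
    ext p q
    rcases p with l | f' | f <;> rcases q with m | g' | g <;>
      simp [transferMatrix, encMatrix, decMatrix, adjMatrix, codeOf, single_apply,
        Function.update_apply]
    grind

open Classical in
omit [Fintype I] [Fintype O] in
theorem transferMatrix_codeOf_map {L : Type*} [Field L] [Algebra K L] (T : Fin N → V) (i : Fin N)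
    (v : (Fin R × O) ⊕ (I × O) ⊕ (I × Fin N × Fin R) → K) :
    G.transferMatrix S T (codeOf fun j => algebraMap K L (v j)) i =
      (G.transferMatrix S T (codeOf v) i).map (algebraMap K L) := by
  ext p q
  rcases p with l | f' | f <;> rcases q with m | g' | g <;>
    simp [transferMatrix, encMatrix, decMatrix, adjMatrix, codeOf, one_apply] <;>
    split_ifs <;> simp

open Classical in
theorem exists_code_forall_det_ne_zero [Fintype K] [Finite V] (hG : G.Acyclic) (T : Fin N → V)
    (hST : ∀ i, T i ≠ S) (hN : N < Fintype.card K) (hcut : ∀ i, R ≤ G.mincut K S (T i)) :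
    ∃ c : ADTCode I O K N R, ∀ i, (G.systemMatrix S T c i).det ≠ 0 := by
  let L := AlgebraicClosure K
  have hinf : Infinite L := IsAlgClosed.instInfinite
  obtain ⟨v, hv, hne⟩ := exists_forall_ne_zero_of_affine
    (fun (i : Fin N) v => (G.transferMatrix (K := L) (R := R) S T (codeOf v) i).det)
    (fun i v j => G.det_transferMatrix_codeOf_affine T i v j)
    (fun i => by
      obtain ⟨c, hc⟩ := G.exists_code_det_transferMatrix_ne_zero (R := R) L T i (hST i)
        ((G.le_mincut_iff (hST i) R).1 (by rw [G.mincut_algebra (F := K)]; exact hcut i))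
      exact ⟨Sum.elim (fun x => c.α x.1 x.2)
        (Sum.elim (fun x => c.β x.1 x.2) fun x => c.ε x.1 x.2.1 x.2.2), hc⟩)
    -- Nonvanishing is witnessed over the closure, but the common nonzero is sought with coordinates
    -- in the image of `K`.
    (Finset.univ.image (algebraMap K L))
    (by rwa [Fintype.card_fin, Finset.card_image_of_injective _ (algebraMap K L).injective,
      Finset.card_univ])
  simp only [Finset.mem_image, Finset.mem_univ, true_and] at hv
  choose u hu using hv
  obtain rfl : (fun j => algebraMap K L (u j)) = v := funext hu
  refine ⟨codeOf u, fun i => hG.det_systemMatrix_ne_zero fun h0 => hne i ?_⟩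
  rw [G.transferMatrix_codeOf_map, ← RingHom.mapMatrix_apply, ← RingHom.map_det, h0, map_zero]

end

end ADTNetwork

/-! ### Large finite extensions and the multicast theorem -/

/-- Adjoining `n + 1` elements of the algebraic closure suffices. -/
theorem exists_finite_extension_card_lt (F : Type u) [Field F] [Finite F] (n : ℕ) :
    ∃ (K : Type u) (_ : Field K) (_ : Fintype K) (_ : Algebra F K), n < Fintype.card K := by
  obtain ⟨s, hs⟩ := Infinite.exists_subset_card_eq (AlgebraicClosure F) (n + 1)
  have hfd : FiniteDimensional F (IntermediateField.adjoin F (s : Set (AlgebraicClosure F))) :=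
    IntermediateField.finiteDimensional_adjoin fun x _ =>
      (Algebra.IsAlgebraic.isAlgebraic (R := F) x).isIntegral
  have hfin : Finite (IntermediateField.adjoin F (s : Set (AlgebraicClosure F))) :=
    Module.finite_of_finite F
  refine ⟨IntermediateField.adjoin F (s : Set (AlgebraicClosure F)), inferInstance,
    Fintype.ofFinite _, inferInstance, ?_⟩
  let _ := Fintype.ofFinite (IntermediateField.adjoin F (s : Set (AlgebraicClosure F)))
  have := Fintype.card_le_of_injective
    (fun x : s => (⟨x.1, IntermediateField.subset_adjoin F _ x.2⟩ :
      IntermediateField.adjoin F (s : Set (AlgebraicClosure F))))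
    (fun x y h => Subtype.ext (congrArg (fun z => z.1) h))
  rw [Fintype.card_coe, hs] at this
  convert Nat.lt_of_succ_le this

theorem mainTheorem3 {V I O : Type*} [Fintype V] [Fintype I] [Fintype O]
    (G : ADTNetwork V I O) (hG : G.Acyclic)
    {F : Type u} [Field F] [Fintype F]
    {N : ℕ} (S : V) (T : Fin N → V) (hST : ∀ i, T i ≠ S) (R : ℕ) :
    ((∃ (K : Type u) (_ : Field K) (_ : Fintype K) (_ : Algebra F K), G.Solvable K S T R) ↔
        ∀ i, R ≤ G.mincut F S (T i)) ∧
    (G.Solvable F S T R → ∀ i, R ≤ G.mincut F S (T i)) ∧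
    (N < Fintype.card F →
      (G.Solvable F S T R ↔ ∀ i, R ≤ G.mincut F S (T i)) ∧
      ((∀ i, R ≤ G.mincut F S (T i)) →
        ∃ c : ADTCode I O F N R, ∀ i, (G.systemMatrix S T c i).det ≠ 0)) := by
  refine ⟨⟨?_, fun h => ?_⟩, fun h => h.le_mincut hG hST, fun hN => ⟨⟨fun h => h.le_mincut hG hST,
    fun h => ?_⟩, G.exists_code_forall_det_ne_zero hG T hST hN⟩⟩
  · rintro ⟨K, _, _, _, h⟩ i
    rw [← G.mincut_algebra (F := F) (K := K)]
    exact h.le_mincut hG hST i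
  · obtain ⟨K, _, _, _, hK⟩ := exists_finite_extension_card_lt F N
    refine ⟨K, inferInstance, inferInstance, inferInstance, ?_⟩
    obtain ⟨c, hc⟩ := G.exists_code_forall_det_ne_zero (K := K) hG T hST hK fun i => by
      rw [G.mincut_algebra (F := F)]
      exact h i
    exact ADTNetwork.solvable_of_det_systemMatrix_ne_zero hG hc
  · obtain ⟨c, hc⟩ := G.exists_code_forall_det_ne_zero hG T hST hN h
    exact ADTNetwork.solvable_of_det_systemMatrix_ne_zero hG hc
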